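/- **Setting.** An instance of facility location is a finite connected undirected graph $G=(V,E)$ with nonnegative edge costs and opening costs $f_v\ge 0$ ($v\in V$); $d$ is the shortest-path distance and $d(F,v)=\min_{u\in F}d(u,v)$, with $d(\emptyset,v)=\infty$. Requests $R=(r_1,\dots,r_{|R|})$ are vertices (repetitions allowed) arriving one per step. The algorithm may open facilities (paying $f_v$ once for each opened $v$) and must connect each arriving request to the closest open facility, paying the distance. $\mathrm{OPT}$ is the minimum of opening plus connection costs over offline solutions serving all of $R$. A prediction $\hat R$ (a finite family of vertices) is given in advance. A pair $(\Delta,D)$ is an *error* of $\hat R$ with respect to $R$ if there are $A\subseteq R$, $B\subseteq\hat R$ with $|A|=|B|$ such that $D$ is the minimum cost of a perfect matching of $A$ to $B$ with respect to $d$, and $\Delta=|R\setminus A|+|\hat R\setminus B|$. **Fotakis' online algorithm** $\mathrm{ON}$ starts with $F=\emptyset$, $L=\emptyset$ and potentials $p\equiv 0$. On a request $r$ it adds $r$ to $L$, increases every $p(v)$ by $(d(F,r)-d(v,r))_+$, and lets $w$ maximize $p(v)-f_v$ (ties are broken by an arbitrary fixed rule). If $p(w)>f_w$, it adds $w$ to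 $F$ and resets $p(v)=\sum_{r'\in L}(d(F,r')-d(v,r'))_+$ for all $v$. (While $F=\emptyset$, the infinite value $d(\emptyset,r)$ is treated as a sufficiently large number, so that the first facility opened minimizes $f_v+d(v,r)$.) The *amortized cost* of $r$ is $\alpha(r)=2\min\{d(F,r),\ \min_{v}(f_v-p(v)+d(v,r))\}$, with $F,p$ taken before $r$ arrives. **Prize-collecting ingredient.** A solution for $\hat R$ opens a set of facilities and connects some of the predicted requests to open facilities; these are the satisfied ones, and $c(S)$ denotes opening plus connection costs. $\mathrm{PC}$ is any algorithm that, for every positive penalty function $\pi$ on $\hat R$, returns a solution for which $c(S)+\sum_{\text{unsatisfied}}\pi$ is at most $\gamma$ times the minimum, where $\gamma\ge1$. Write $\mathrm{PC}(x)$ for its output when all penalties equal $x$. **Partial**$(u)$: if $\gamma u\ge|\hat R|$, return the empty solution. Otherwise let $i$ be the minimum integer such that $\mathrm{PC}(2^i)$ leaves at most $\gamma u$ requests unsatisfied, let $S_1=\mathrm{PC}(2^{i-1})$, $S_2=\mathrm{PC}(2^i)$, and let $u_1,u_2$ be their numbers of unsatisfied requests; return $S_1$ if $\gamma u\ge (u_1+u_2)/2$,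 and $S_2$ otherwise. (If there is no minimum because arbitrarily small $i$ qualify, which can only happen if some opening costs are $0$, return $\mathrm{PC}(2^i)$ for some qualifying $i$ for which this solution has cost $0$.) **Framework.** Start with $B=\hat B=0$, no open facilities and a new instance of $\mathrm{ON}$. On a request $r$: send $r$ to the current instance of $\mathrm{ON}$, open the facilities it opens, connect $r$ to the closest open facility, and increase $B$ by the amortized cost $\alpha(r)$ in this instance. If now $B\ge 2\hat B$, set $\hat B=B$, let $u\in\{0,\dots,|\hat R|\}$ be minimum with $c(\mathrm{Partial}(u))\le 3\gamma\hat B$, open the facilities of $\mathrm{Partial}(u)$, and start a new instance of $\mathrm{ON}$ in which the opening costs of all facilities that are open so far are $0$. Let $\mathrm{ALG}$ be the total actual cost: the opening costs of all facilities opened plus the connection costs of all requests. **Theorem.** For every $\gamma\ge 1$ there is a constant $C>0$ depending only on $\gamma$ such that, for every instance, every request sequence $R$, every prediction $\hat R$, every $\gamma$-approximation $\mathrm{PC}$ as above, and every error $(\Delta,D)$ of $\hat R$ with respect to $R$, $$\mathrm{ALG}\ \le\ C\,\log\bigl(\min\{|R|,\Delta\}+2\bigr)\cdot \mathrm{OPT}+C\cdot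 D .$$ -/

import Mathlib

noncomputable section

namespace FacilityLocation

/-- An (uncapacitated) facility location instance: a connected undirected graph with nonnegative
edge costs and nonnegative facility opening costs at the vertices. -/
structure Instance (V : Type*) where
  graph : SimpleGraph V
  edgeCost : Sym2 V → ℝ
  openCost : V → ℝ
  connected : graph.Connected
  edgeCost_nonneg : ∀ e ∈ graph.edgeSet, 0 ≤ edgeCost e
  openCost_nonneg : ∀ v, 0 ≤ openCost v

/-- An offline solution for `m` requests: a set of open facilities, and for each request either
the open facility it is connected to, or `none` if the request is not satisfied. -/
structure Solution (V : Type*) (m : ℕ) where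
  opened : Finset V
  assign : Fin m → Option V
  assign_mem : ∀ j v, assign j = some v → v ∈ opened

/-- The empty solution: nothing is opened, nothing is connected. -/
def Solution.empty (V : Type*) (m : ℕ) : Solution V m where
  opened := ∅
  assign := fun _ => none
  assign_mem := by simp

/-- The requests that are not satisfied by a solution. -/
def Solution.unserved {V : Type*} {m : ℕ} (S : Solution V m) : Finset (Fin m) :=
  Finset.univ.filter fun j => (S.assign j).isNone

namespace Instance

variable {V : Type*}

/-- Shortest path distance in the graph. -/
def dist (I : Instance V) (u v : V) : ℝ :=
  ⨅ p : I.graph.Walk u v, (p.edges.map I.edgeCost).sum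

/-- `d(F, v) = min_{u ∈ F} d(u, v)`. This is only used for nonempty `F`. -/
def distTo (I : Instance V) (F : Finset V) (v : V) : ℝ :=
  ⨅ u : {x // x ∈ F}, I.dist u.1 v

/-- The same instance in which the facilities of `S` cost nothing to open. -/
def withFree [DecidableEq V] (I : Instance V) (S : Finset V) : Instance V :=
  { I with
    openCost := fun v => if v ∈ S then 0 else I.openCost v
    openCost_nonneg := fun v => by
      by_cases h : v ∈ S
      · simp [h]
      · simpa [h] using I.openCost_nonneg v }

/-! ### Offline costs -/

/-- Opening costs plus connection costs of a solution. -/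
def cost (I : Instance V) {m : ℕ} (req : Fin m → V) (S : Solution V m) : ℝ :=
  ∑ v ∈ S.opened, I.openCost v + ∑ j, (S.assign j).elim 0 fun v => I.dist v (req j)

/-- The minimum cost of a solution that satisfies all requests. -/
def opt (I : Instance V) {n : ℕ} (req : Fin n → V) : ℝ :=
  sInf {x | ∃ S : Solution V n, S.unserved = ∅ ∧ x = I.cost req S}

/-- Prize-collecting objective: the cost of the solution plus the penalties of the requests that
it does not satisfy. -/
def prizeCost (I : Instance V) {m : ℕ} (req : Fin m → V) (pen : Fin m → ℝ)
    (S : Solution V m) : ℝ :=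
  I.cost req S + ∑ j ∈ S.unserved, pen j

/-- `PC`, which maps penalties to solutions, is a `γ`-approximation for prize-collecting facility
location on the requests `req`. -/
def IsPrizeCollectingApprox (I : Instance V) (γ : ℝ) {m : ℕ} (req : Fin m → V)
    (PC : (Fin m → ℝ) → Solution V m) : Prop :=
  ∀ pen : Fin m → ℝ, (∀ j, 0 < pen j) →
    ∀ T : Solution V m, I.prizeCost req pen (PC pen) ≤ γ * I.prizeCost req pen T

/-! ### Prediction error -/

/-- `(Δ, D)` is a metric error with outliers of the prediction `Rhat` with respect to `R`: for some
equally large sets `A` of requests and `B` of predictions, `D` is the minimum cost of a perfect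
matching between `A` and `B`, and `Δ` requests and predictions in total are left out. -/
def IsMetricError (I : Instance V) {n m : ℕ} (R : Fin n → V) (Rhat : Fin m → V)
    (Δ : ℕ) (D : ℝ) : Prop :=
  ∃ (A : Finset (Fin n)) (B : Finset (Fin m)),
    A.card = B.card ∧
    IsLeast {x : ℝ | ∃ e : {i // i ∈ A} ≃ {j // j ∈ B},
      x = ∑ i, I.dist (R i.1) (Rhat (e i).1)} D ∧
    Aᶜ.card + Bᶜ.card = Δ

end Instance

/-! ### Fotakis' online algorithm -/

/-- State of the online algorithm: open facilities `F`, requests `L` seen so far (a repeated vertex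
is a repeated request), potentials `p`. -/
structure OnlineState (V : Type*) where
  F : Finset V
  L : List V
  p : V → ℝ

def OnlineState.init (V : Type*) : OnlineState V := ⟨∅, [], fun _ => 0⟩

namespace Instance

variable {V : Type*}

/-- The potential of `v` computed from scratch: `∑_{r ∈ L} (d(F, r) - d(v, r))₊`. -/
def newPotential (I : Instance V) (F : Finset V) (L : List V) (v : V) : ℝ :=
  (L.map fun r => max (I.distTo F r - I.dist v r) 0).sum

/-- The updated potential of `v` upon the arrival of `r`. If no facility is open yet, then
`d(∅, r) = ∞` and all updated potentials are infinite; they are compared as for a large finite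
value of `d(∅, r)`, which is a summand common to all vertices and is left out here. -/
def updPotential [DecidableEq V] (I : Instance V) (s : OnlineState V) (r v : V) : ℝ :=
  if s.F = ∅ then s.p v - I.dist v r
  else s.p v + max (I.distTo s.F r - I.dist v r) 0

/-- The online algorithm serves request `r`; `argmax` picks a maximizer and so fixes how ties are
broken. While no facility is open, potentials are infinite, so that a facility is always opened. -/
def onlineStep [DecidableEq V] (I : Instance V) (argmax : (V → ℝ) → V)
    (s : OnlineState V) (r : V) : OnlineState V :=
  let L := s.L ++ [r]
  let p := I.updPotential s r
  let w := argmax fun v => p v - I.openCost v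
  if s.F = ∅ ∨ I.openCost w < p w then
    ⟨insert w s.F, L, I.newPotential (insert w s.F) L⟩
  else
    ⟨s.F, L, p⟩

/-- Amortized cost of request `r` arriving in state `s`:
`2 · min {d(F, r), min_v (f_v - p(v) + d(v, r))}`, where `d(∅, r) = ∞`. -/
def amortizedCost [DecidableEq V] (I : Instance V) (s : OnlineState V) (r : V) : ℝ :=
  if s.F = ∅ then 2 * ⨅ v, (I.openCost v - s.p v + I.dist v r)
  else 2 * min (I.distTo s.F r) (⨅ v, (I.openCost v - s.p v + I.dist v r))

/-! ### The framework -/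

/-- The exponents `i` for which `PC` with uniform penalty `2 ^ i` leaves at most `γ u` requests
unsatisfied. -/
def goodExponents (γ : ℝ) {m : ℕ} (PC : (Fin m → ℝ) → Solution V m) (u : ℕ) : Set ℤ :=
  {i | ((PC fun _ => (2 : ℝ) ^ i).unserved.card : ℝ) ≤ γ * u}

open Classical in
/-- The subroutine `Partial` with allowance `u`. If no minimum exponent exists (arbitrarily small
penalties qualify, which requires facilities that cost nothing), it returns a solution of cost
zero among the `PC` solutions for the qualifying exponents. -/
def partialSol (I : Instance V) (γ : ℝ) {m : ℕ} (Rhat : Fin m → V)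
    (PC : (Fin m → ℝ) → Solution V m) (u : ℕ) : Solution V m :=
  if (m : ℝ) ≤ γ * u then Solution.empty V m
  else if h : ∃ i, IsLeast (goodExponents γ PC u) i then
    let S₁ := PC fun _ => (2 : ℝ) ^ (h.choose - 1)
    let S₂ := PC fun _ => (2 : ℝ) ^ h.choose
    if ((S₁.unserved.card : ℝ) + S₂.unserved.card) / 2 ≤ γ * u then S₁ else S₂
  else
    PC fun _ => (2 : ℝ) ^ (Classical.epsilon fun i : ℤ =>
      i ∈ goodExponents γ PC u ∧ I.cost Rhat (PC fun _ => (2 : ℝ) ^ i) = 0)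

/-- The `Partial` solution that is bought with the value `Bhat`: the one with minimum `u` among
those of cost at most `3 γ Bhat`. -/
def boughtSol (I : Instance V) (γ : ℝ) {m : ℕ} (Rhat : Fin m → V)
    (PC : (Fin m → ℝ) → Solution V m) (Bhat : ℝ) : Solution V m :=
  I.partialSol γ Rhat PC
    (sInf {u : ℕ | u ≤ m ∧ I.cost Rhat (I.partialSol γ Rhat PC u) ≤ 3 * γ * Bhat})

end Instance

/-- State of the framework: the counters `B` and `Bhat`, the set `S` of open facilities, the set
`S₀` of facilities that are free for the current instance of the online algorithm, the state of
that instance, and the total connection cost paid so far. -/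
structure FrameworkState (V : Type*) where
  B : ℝ
  Bhat : ℝ
  S : Finset V
  S₀ : Finset V
  online : OnlineState V
  connCost : ℝ

def FrameworkState.init (V : Type*) : FrameworkState V :=
  ⟨0, 0, ∅, ∅, OnlineState.init V, 0⟩

namespace Instance

variable {V : Type*} [DecidableEq V]

/-- The framework serves request `r`. The online algorithm is charged its amortized cost. The client
is connected to the closest facility that is open after the step of the online algorithm. A
`Partial` solution is added by opening its facilities. -/
def frameworkStep (I : Instance V) (argmax : (V → ℝ) → V) (γ : ℝ) {m : ℕ} (Rhat : Fin m → V)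
    (PC : (Fin m → ℝ) → Solution V m) (s : FrameworkState V) (r : V) : FrameworkState V :=
  let J := I.withFree s.S₀
  let B := s.B + J.amortizedCost s.online r
  let on := J.onlineStep argmax s.online r
  let S := s.S ∪ on.F
  let conn := s.connCost + I.distTo S r
  if 2 * s.Bhat ≤ B then
    let S' := S ∪ (I.boughtSol γ Rhat PC B).opened
    ⟨B, B, S', S', OnlineState.init V, conn⟩
  else
    ⟨B, s.Bhat, S, s.S₀, on, conn⟩

/-- The state after the framework has served the sequence `R`, given the prediction `Rhat`. -/
def finalState (I : Instance V) (argmax : (V → ℝ) → V) (γ : ℝ) {n m : ℕ} (R : Fin n → V)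
    (Rhat : Fin m → V) (PC : (Fin m → ℝ) → Solution V m) : FrameworkState V :=
  (List.ofFn R).foldl (I.frameworkStep argmax γ Rhat PC) (FrameworkState.init V)

/-- Actual cost of the framework on the sequence `R`: the opening costs of all the facilities it
opens, plus all connection costs. -/
def algCost (I : Instance V) (argmax : (V → ℝ) → V) (γ : ℝ) {n m : ℕ} (R : Fin n → V)
    (Rhat : Fin m → V) (PC : (Fin m → ℝ) → Solution V m) : ℝ :=
  ∑ v ∈ (I.finalState argmax γ R Rhat PC).S, I.openCost v +
    (I.finalState argmax γ R Rhat PC).connCost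

end Instance

end FacilityLocation

end

/-! Fix an offline solution `T` serving `R` and put `Q = cost(T) + D`. Three facts carry the proof.

Fotakis' algorithm (`onlineStep_spec`): half of the amortized cost pays for the connection of each
request, and half of it also pays for any increase of opening plus reassignment costs. The amortized
cost is in turn bounded against `T` (`amortSum_le_harmonic`): the k-th charged request of a cluster
of `T` pays about a 1/k share of the cluster's cost, which sums to a harmonic number, while a
request near a free facility pays only twice its distance.

`Partial` (`partialSol_unserved_card_le`, `cost_partialSol_le`): averaging two consecutive penalties
leaves at most `2γu` predictions unsatisfied, at cost at most `3γ` times that of any solution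
leaving out at most `u`. Moving `T` along the matching gives such a comparison solution of cost at
most `Q`.

Doubling (`algCost_le_of_phases`): the budgets at purchases grow geometrically, so the total cost is
O(γ) times the last `Bhat`. When `Bhat` first exceeds `Q` it is at most `4Q`, and the solution
bought then makes facilities free near all but at most `(1 + 2γ)Δ` requests. Every later phase thus
has amortized cost at most some `X` = O(D + γQ + H_N cost(T)), where `N` is about `(1 + 2γ) min(n,
Δ)`. A phase ends only when its amortized cost reaches `Bhat`, so `Bhat` never exceeds `4Q + 2X`. -/

namespace FacilityLocation

namespace Instance

/-! ### Shortest-path distances and distances to facility sets. -/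

section Metric

variable {V : Type*} (I : Instance V)

theorem walkCost_nonneg {u v : V} (p : I.graph.Walk u v) :
    0 ≤ (p.edges.map I.edgeCost).sum := by
  refine List.sum_nonneg fun x hx => ?_
  obtain ⟨e, he, rfl⟩ := List.mem_map.1 hx
  exact I.edgeCost_nonneg e (p.edges_subset_edgeSet he)

theorem dist_le_walkCost {u v : V} (p : I.graph.Walk u v) :
    I.dist u v ≤ (p.edges.map I.edgeCost).sum :=
  ciInf_le ⟨0, by rintro _ ⟨q, rfl⟩; exact I.walkCost_nonneg q⟩ p

theorem dist_nonneg (u v : V) : 0 ≤ I.dist u v :=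
  Real.iInf_nonneg fun p => I.walkCost_nonneg p

theorem dist_comm_le (u v : V) : I.dist u v ≤ I.dist v u := by
  have : Nonempty (I.graph.Walk v u) := I.connected.preconnected v u
  refine le_ciInf fun p => (I.dist_le_walkCost p.reverse).trans (le_of_eq ?_)
  rw [SimpleGraph.Walk.edges_reverse, List.map_reverse, List.sum_reverse]

theorem dist_comm (u v : V) : I.dist u v = I.dist v u :=
  le_antisymm (I.dist_comm_le u v) (I.dist_comm_le v u)

theorem dist_triangle (u v w : V) : I.dist u w ≤ I.dist u v + I.dist v w := by
  have : Nonempty (I.graph.Walk u v) := I.connected.preconnected u v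
  have : Nonempty (I.graph.Walk v w) := I.connected.preconnected v w
  refine le_ciInf_add_ciInf fun p q => (I.dist_le_walkCost (p.append q)).trans (le_of_eq ?_)
  rw [SimpleGraph.Walk.edges_append, List.map_append, List.sum_append]

theorem distTo_le {F : Finset V} {u : V} (hu : u ∈ F) (v : V) : I.distTo F v ≤ I.dist u v :=
  ciInf_le (f := fun u : {x // x ∈ F} => I.dist u.1 v) (Set.finite_range _).bddBelow ⟨u, hu⟩

theorem distTo_nonneg (F : Finset V) (v : V) : 0 ≤ I.distTo F v :=
  Real.iInf_nonneg fun u => I.dist_nonneg u.1 v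

theorem le_distTo {F : Finset V} (hF : F.Nonempty) {v : V} {x : ℝ}
    (h : ∀ u ∈ F, x ≤ I.dist u v) : x ≤ I.distTo F v := by
  have : Nonempty {x // x ∈ F} := hF.to_subtype
  exact le_ciInf fun u => h u.1 u.2

/-- Nonemptiness is essential: the real infimum over the empty set is 0, so `distTo ∅` is 0 and not
infinite. -/
theorem distTo_anti {F G : Finset V} (hF : F.Nonempty) (h : F ⊆ G) (v : V) :
    I.distTo G v ≤ I.distTo F v :=
  I.le_distTo hF fun _ hu => I.distTo_le (h hu) v

theorem distTo_singleton (u v : V) : I.distTo {u} v = I.dist u v :=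
  le_antisymm (I.distTo_le (by simp) v) (I.le_distTo (by simp) (by simp))

theorem distTo_insert [DecidableEq V] {F : Finset V} (hF : F.Nonempty) (w v : V) :
    I.distTo (insert w F) v = min (I.distTo F v) (I.dist w v) := by
  refine le_antisymm (le_min (I.distTo_anti hF (Finset.subset_insert w F) v)
    (I.distTo_le (Finset.mem_insert_self w F) v)) (I.le_distTo (Finset.insert_nonempty w F) ?_)
  intro u hu
  rcases Finset.mem_insert.1 hu with rfl | hu
  · exact min_le_right _ _
  · exact (min_le_left _ _).trans (I.distTo_le hu v)

theorem distTo_le_distTo_add_dist {F : Finset V} (hF : F.Nonempty) (u v : V) :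
    I.distTo F u ≤ I.distTo F v + I.dist v u := by
  rw [← sub_le_iff_le_add]
  refine I.le_distTo hF fun x hx => ?_
  linarith [I.distTo_le hx u, I.dist_triangle x v u]

end Metric

/-! ### One step of the online algorithm. -/

section Online

variable {V : Type*} (I : Instance V)

theorem newPotential_nonneg (F : Finset V) (L : List V) (v : V) : 0 ≤ I.newPotential F L v := by
  refine List.sum_nonneg fun x hx => ?_
  obtain ⟨e, -, rfl⟩ := List.mem_map.1 hx
  exact le_max_right _ _

theorem newPotential_append_singleton (F : Finset V) (L : List V) (r v : V) :
    I.newPotential F (L ++ [r]) v =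
      I.newPotential F L v + max (I.distTo F r - I.dist v r) 0 := by
  simp [newPotential]

theorem newPotential_insert_le [DecidableEq V] {F : Finset V} (hF : F.Nonempty) (L : List V)
    (w v : V) : I.newPotential (insert w F) L v ≤ I.newPotential F L v := by
  refine List.sum_le_sum fun r _ => max_le_max (sub_le_sub_right ?_ _) le_rfl
  exact I.distTo_anti hF (Finset.subset_insert w F) r

/-- The total distance of the requests seen so far to the open facilities. -/
noncomputable def assignCost (F : Finset V) (L : List V) : ℝ := (L.map (I.distTo F)).sum

theorem assignCost_nonneg (F : Finset V) (L : List V) : 0 ≤ I.assignCost F L := by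
  refine List.sum_nonneg fun x hx => ?_
  obtain ⟨e, -, rfl⟩ := List.mem_map.1 hx
  exact I.distTo_nonneg F e

theorem assignCost_append_singleton (F : Finset V) (L : List V) (r : V) :
    I.assignCost F (L ++ [r]) = I.assignCost F L + I.distTo F r := by
  simp [assignCost]

/-- The potential of `w` is exactly the reassignment saving from opening `w`. -/
theorem assignCost_insert [DecidableEq V] {F : Finset V} (hF : F.Nonempty) (L : List V) (w : V) :
    I.assignCost (insert w F) L = I.assignCost F L - I.newPotential F L w := by
  induction L with
  | nil => simp [assignCost, newPotential]
  | cons r L ih =>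
    simp only [assignCost, newPotential, List.map_cons, List.sum_cons] at ih ⊢
    rw [ih, I.distTo_insert hF]
    rcases le_total (I.distTo F r) (I.dist w r) with h | h
    · rw [min_eq_left h, max_eq_right (by linarith)]; ring
    · rw [min_eq_right h, max_eq_left (by linarith)]; ring

/-- The invariants of the online algorithm. -/
structure ValidState (s : OnlineState V) : Prop where
  seen_eq : s.F = ∅ → s.L = []
  pot_eq : ∀ v, s.p v = I.newPotential s.F s.L v
  pot_le : ∀ v, s.p v ≤ I.openCost v

theorem validState_init : I.ValidState (OnlineState.init V) where
  seen_eq _ := rfl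
  pot_eq _ := by simp [OnlineState.init, newPotential]
  pot_le v := I.openCost_nonneg v

variable {I} in
theorem ValidState.pot_nonneg {s : OnlineState V} (hs : I.ValidState s) (v : V) : 0 ≤ s.p v := by
  rw [hs.pot_eq]; exact I.newPotential_nonneg _ _ _

variable {I} in
theorem ValidState.pot_eq_zero {s : OnlineState V} (hs : I.ValidState s) (hF : s.F = ∅) (v : V) :
    s.p v = 0 := by
  rw [hs.pot_eq, hs.seen_eq hF]; rfl

variable [DecidableEq V]

theorem amortizedCost_le [Finite V] (s : OnlineState V) (r v : V) :
    I.amortizedCost s r ≤ 2 * (I.openCost v - s.p v + I.dist v r) := by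
  have h : (⨅ v, (I.openCost v - s.p v + I.dist v r)) ≤ I.openCost v - s.p v + I.dist v r :=
    ciInf_le (f := fun v => I.openCost v - s.p v + I.dist v r) (Set.finite_range _).bddBelow v
  unfold amortizedCost
  split_ifs
  · linarith
  · linarith [min_le_right (I.distTo s.F r) (⨅ v, (I.openCost v - s.p v + I.dist v r))]

theorem amortizedCost_le_distTo {s : OnlineState V} (hF : s.F.Nonempty) (r : V) :
    I.amortizedCost s r ≤ 2 * I.distTo s.F r := by
  unfold amortizedCost
  rw [if_neg hF.ne_empty]
  linarith [min_le_left (I.distTo s.F r) (⨅ v, (I.openCost v - s.p v + I.dist v r))]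

theorem le_amortizedCost {s : OnlineState V} {r : V} {x : ℝ}
    (h₁ : s.F.Nonempty → x ≤ I.distTo s.F r)
    (h₂ : ∀ v, x ≤ I.openCost v - s.p v + I.dist v r) : 2 * x ≤ I.amortizedCost s r := by
  have : Nonempty V := ⟨r⟩
  have h : x ≤ ⨅ v, (I.openCost v - s.p v + I.dist v r) := le_ciInf h₂
  unfold amortizedCost
  split_ifs with hF
  · linarith
  · linarith [le_min (h₁ (Finset.nonempty_iff_ne_empty.2 hF)) h]

/-- One step of the online algorithm preserves the invariants, and the amortized cost pays for
the connection cost of the request and for the change of the opening and reassignment costs. -/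
structure StepSpec (s t : OnlineState V) (r : V) : Prop where
  valid : I.ValidState t
  nonempty : t.F.Nonempty
  subset : s.F ⊆ t.F
  seen : t.L = s.L ++ [r]
  conn_le : 2 * I.distTo t.F r ≤ I.amortizedCost s r
  cost_le : 2 * (∑ v ∈ t.F, I.openCost v + I.assignCost t.F t.L) ≤
    2 * (∑ v ∈ s.F, I.openCost v + I.assignCost s.F s.L) + I.amortizedCost s r

variable {argmax : (V → ℝ) → V} (hmax : ∀ (g : V → ℝ) (v : V), g v ≤ g (argmax g))
include hmax

theorem onlineStep_spec {s : OnlineState V} (hs : I.ValidState s) (r : V) :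
    I.StepSpec s (I.onlineStep argmax s r) r := by
  dsimp only [onlineStep]
  set w := argmax fun v => I.updPotential s r v - I.openCost v
  have hwm : ∀ v, I.updPotential s r v - I.openCost v ≤ I.updPotential s r w - I.openCost w :=
    fun v => hmax (fun v => I.updPotential s r v - I.openCost v) v
  by_cases hF : s.F = ∅
  -- First request: there are no earlier requests and `w` minimizes `f_v + d(v, r)`, so half of the
  -- amortized cost is exactly what is paid.
  · have hp := hs.pot_eq_zero hF
    have hL := hs.seen_eq hF
    simp only [updPotential, hF, if_true, hp] at hwm
    have ha : 2 * (I.openCost w + I.dist w r) ≤ I.amortizedCost s r := by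
      refine I.le_amortizedCost (fun h => absurd hF h.ne_empty) fun v => ?_
      have := hwm v
      rw [hp]; linarith
    have hf := I.openCost_nonneg w
    simp only [hF, hL, true_or, if_true, List.nil_append, insert_empty_eq]
    refine ⟨⟨by simp, fun v => rfl, fun v => ?_⟩, by simp, by simp [hF], by simp [hL], ?_, ?_⟩
    · simp only [newPotential, List.map_cons, List.map_nil, List.sum_cons, List.sum_nil, add_zero,
        distTo_singleton]
      refine max_le ?_ (I.openCost_nonneg v)
      linarith [hwm v]
    · simp only [distTo_singleton]; linarith
    · simp only [assignCost, hF, hL, Finset.sum_singleton, Finset.sum_empty, List.map_cons,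
        List.map_nil, List.sum_cons, List.sum_nil, distTo_singleton]
      linarith
  · have hne : s.F.Nonempty := Finset.nonempty_iff_ne_empty.2 hF
    have hupd : ∀ v, I.updPotential s r v = s.p v + max (I.distTo s.F r - I.dist v r) 0 := by
      intro v; simp [updPotential, hF]
    by_cases hopen : I.openCost w < I.updPotential s r w
    · simp only [hF, false_or, hopen, if_true]
      simp only [hupd] at hopen hwm
      -- Before `r` the potential of `w` was at most its opening cost, so only a positive
      -- contribution of `r` can trigger the opening.
      have hlt : I.dist w r < I.distTo s.F r := by
        by_contra! h
        rw [max_eq_right (by linarith)] at hopen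
        linarith [hs.pot_le w]
      rw [max_eq_left (by linarith)] at hopen hwm
      have hd : I.distTo (insert w s.F) r = I.dist w r := by
        rw [I.distTo_insert hne, min_eq_right hlt.le]
      have ha : 2 * (I.openCost w - s.p w + I.dist w r) ≤ I.amortizedCost s r := by
        refine I.le_amortizedCost (fun _ => by linarith) fun v => ?_
        linarith [hwm v, le_max_left (I.distTo s.F r - I.dist v r) 0]
      refine ⟨⟨by simp, fun v => rfl, fun v => ?_⟩, by simp, Finset.subset_insert _ _, rfl, ?_, ?_⟩
      -- After the reset, potentials stay below opening costs: `r` contributes at most `d(w, r) -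
      -- d(v, r)` when positive, and maximality of `w` bounds `p(v) + d(w, r) - d(v, r) - f_v` by
      -- `p(w) - f_w ≤ 0`.
      · simp only [newPotential_append_singleton, hd]
        have h1 := I.newPotential_insert_le hne s.L w v
        rw [← hs.pot_eq] at h1
        rcases le_total (I.dist w r) (I.dist v r) with h | h
        · rw [max_eq_right (by linarith)]; linarith [hs.pot_le v]
        · rw [max_eq_left (by linarith)]
          linarith [hwm v, hs.pot_le w, le_max_left (I.distTo s.F r - I.dist v r) 0]
      · simp only [hd]; linarith [hs.pot_le w]
      · have hsum : ∑ v ∈ insert w s.F, I.openCost v ≤ I.openCost w + ∑ v ∈ s.F, I.openCost v := by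
          by_cases hmem : w ∈ s.F
          · rw [Finset.insert_eq_of_mem hmem]; linarith [I.openCost_nonneg w]
          · rw [Finset.sum_insert hmem]
        -- Opening `w` costs `f_w`, reassigning earlier requests saves `p(w)`, and `r` pays `d(w,
        -- r)`: together half of the amortized cost.
        dsimp only
        rw [assignCost_append_singleton, hd, I.assignCost_insert hne, ← hs.pot_eq]
        linarith
    · simp only [hF, false_or, hopen, if_false]
      simp only [hupd, not_lt] at hopen hwm
      -- No opening means that `d(F, r)` attains the minimum in the amortized cost.
      have hle : ∀ v, s.p v + max (I.distTo s.F r - I.dist v r) 0 ≤ I.openCost v := fun v => by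
        linarith [hwm v]
      have ha : 2 * I.distTo s.F r ≤ I.amortizedCost s r := by
        refine I.le_amortizedCost (fun _ => le_rfl) fun v => ?_
        linarith [hle v, le_max_left (I.distTo s.F r - I.dist v r) 0]
      refine ⟨⟨fun h => absurd h hF, fun v => ?_, fun v => ?_⟩, hne, Finset.Subset.refl _, rfl,
        ha, ?_⟩
      · simp only [hupd, newPotential_append_singleton, hs.pot_eq]
      · simp only [hupd]; exact hle v
      · simp only [assignCost_append_singleton]; linarith

end Online

/-! ### Amortized cost of a whole run against an offline solution. -/

section Run

variable {V : Type*} [DecidableEq V] (I : Instance V) (argmax : (V → ℝ) → V)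

/-- The state of the online algorithm after it has served the requests `l`. -/
noncomputable def runOnline (l : List V) : OnlineState V :=
  l.foldl (I.onlineStep argmax) (OnlineState.init V)

/-- The total amortized cost of the requests `l` arriving from state `s` on. -/
noncomputable def amortSumFrom : OnlineState V → List V → ℝ
  | _, [] => 0
  | s, r :: l => I.amortizedCost s r + amortSumFrom (I.onlineStep argmax s r) l

/-- The total amortized cost of the requests `l` for the online algorithm. -/
noncomputable def amortSum (l : List V) : ℝ := I.amortSumFrom argmax (OnlineState.init V) l

theorem runOnline_append_singleton (l : List V) (r : V) :
    I.runOnline argmax (l ++ [r]) = I.onlineStep argmax (I.runOnline argmax l) r := by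
  simp [runOnline]

theorem amortSumFrom_append_singleton (l : List V) (r : V) (s : OnlineState V) :
    I.amortSumFrom argmax s (l ++ [r]) =
      I.amortSumFrom argmax s l + I.amortizedCost (l.foldl (I.onlineStep argmax) s) r := by
  induction l generalizing s with
  | nil => simp [amortSumFrom]
  | cons a l ih => simp only [List.cons_append, amortSumFrom, List.foldl_cons, ih, add_assoc]

theorem amortSum_append_singleton (l : List V) (r : V) :
    I.amortSum argmax (l ++ [r]) =
      I.amortSum argmax l + I.amortizedCost (I.runOnline argmax l) r :=
  I.amortSumFrom_append_singleton argmax l r _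

variable {argmax} (hmax : ∀ (g : V → ℝ) (v : V), g v ≤ g (argmax g))
include hmax

theorem runOnline_valid_and_seen (l : List V) :
    I.ValidState (I.runOnline argmax l) ∧ (I.runOnline argmax l).L = l := by
  induction l using List.reverseRecOn with
  | nil => exact ⟨I.validState_init, rfl⟩
  | append_singleton l r ih =>
    have h := I.onlineStep_spec hmax ih.1 r
    rw [runOnline_append_singleton]
    exact ⟨h.valid, by rw [h.seen, ih.2]⟩

theorem runOnline_nonempty {l : List V} (hl : l ≠ []) : (I.runOnline argmax l).F.Nonempty := by
  obtain ⟨h, hL⟩ := I.runOnline_valid_and_seen hmax l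
  rw [Finset.nonempty_iff_ne_empty]
  intro hF
  exact hl (hL.symm.trans (h.seen_eq hF))

theorem runOnline_cost_le (l : List V) :
    2 * (∑ v ∈ (I.runOnline argmax l).F, I.openCost v +
      I.assignCost (I.runOnline argmax l).F (I.runOnline argmax l).L) ≤ I.amortSum argmax l := by
  induction l using List.reverseRecOn with
  | nil => simp [runOnline, OnlineState.init, assignCost, amortSum, amortSumFrom]
  | append_singleton l r ih =>
    have h := (I.onlineStep_spec hmax (I.runOnline_valid_and_seen hmax l).1 r).cost_le
    rw [runOnline_append_singleton, amortSum_append_singleton]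
    linarith

theorem runOnline_openCost_le (l : List V) :
    2 * ∑ v ∈ (I.runOnline argmax l).F, I.openCost v ≤ I.amortSum argmax l := by
  linarith [I.runOnline_cost_le hmax l,
    I.assignCost_nonneg (I.runOnline argmax l).F (I.runOnline argmax l).L]

theorem amortSum_nonneg (l : List V) : 0 ≤ I.amortSum argmax l := by
  have := I.runOnline_openCost_le hmax l
  have := Finset.sum_nonneg fun v (_ : v ∈ (I.runOnline argmax l).F) => I.openCost_nonneg v
  linarith

variable [Finite V] {ι : Type*} (R : ι → V)

theorem amortizedCost_runOnline_le (l : List V) (r v : V) :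
    I.amortizedCost (I.runOnline argmax l) r ≤ 2 * (I.openCost v + I.dist v r) := by
  have h := (I.runOnline_valid_and_seen hmax l).1
  linarith [I.amortizedCost_le (I.runOnline argmax l) r v, h.pot_nonneg v]

variable [DecidableEq ι]

/-- With k = |K|, average k copies of the bound `2(d(F, c) + d(c, r))` with one copy of `2(f_c -
p(c) + d(c, r))`. The requests in `K` force `p(c) ≥ k d(F, c) - 2 ∑ d(c, R i)`, so the unknown `d(F,
c)` cancels. -/
theorem amortizedCost_runOnline_le_of_cluster {q : List ι} (hq : q.Nodup) {K : Finset ι}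
    (hK : K ⊆ q.toFinset) (r c : V) :
    I.amortizedCost (I.runOnline argmax (q.map R)) r ≤
      2 * (I.dist c r + I.openCost c / (K.card + 1) +
        2 * (∑ i ∈ K, I.dist c (R i)) / (K.card + 1)) := by
  rcases K.eq_empty_or_nonempty with rfl | hne
  · have := I.amortizedCost_runOnline_le hmax (q.map R) r c
    simp only [Finset.card_empty, Nat.cast_zero, zero_add, div_one, Finset.sum_empty]
    linarith
  obtain ⟨hs, hL⟩ := I.runOnline_valid_and_seen hmax (q.map R)
  have hq0 : q.map R ≠ [] := by
    obtain ⟨i, hi⟩ := hne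
    exact List.ne_nil_of_mem (List.mem_map_of_mem (List.mem_toFinset.1 (hK hi)))
  have hF := I.runOnline_nonempty hmax hq0
  set s := I.runOnline argmax (q.map R)
  have h1 := I.amortizedCost_le_distTo hF r
  have h2 := I.amortizedCost_le s r c
  have h3 := I.distTo_le_distTo_add_dist hF r c
  have h4 : K.card * I.distTo s.F c - 2 * ∑ i ∈ K, I.dist c (R i) ≤ s.p c := by
    have hpot : s.p c = ∑ i ∈ q.toFinset, max (I.distTo s.F (R i) - I.dist c (R i)) 0 := by
      rw [hs.pot_eq, hL, newPotential, List.map_map, List.sum_toFinset _ hq]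
      rfl
    rw [hpot]
    calc K.card * I.distTo s.F c - 2 * ∑ i ∈ K, I.dist c (R i)
        = ∑ i ∈ K, (I.distTo s.F c - 2 * I.dist c (R i)) := by
          rw [Finset.sum_sub_distrib, Finset.mul_sum]; simp
      _ ≤ ∑ i ∈ K, max (I.distTo s.F (R i) - I.dist c (R i)) 0 := by
          refine Finset.sum_le_sum fun i _ => le_max_of_le_left ?_
          linarith [I.distTo_le_distTo_add_dist hF c (R i), I.dist_comm (R i) c]
      _ ≤ _ := Finset.sum_le_sum_of_subset_of_nonneg hK fun _ _ _ => le_max_right _ _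
  have hk : (0 : ℝ) < K.card + 1 := by positivity
  have h5 : K.card * I.amortizedCost s r ≤ K.card * (2 * (I.distTo s.F c + I.dist c r)) :=
    mul_le_mul_of_nonneg_left (by linarith) (by positivity)
  have : 2 * (I.dist c r + I.openCost c / (K.card + 1) +
      2 * (∑ i ∈ K, I.dist c (R i)) / (K.card + 1)) =
      (2 * (I.dist c r * (K.card + 1) + I.openCost c + 2 * ∑ i ∈ K, I.dist c (R i))) /
        (K.card + 1) := by
    field_simp
  rw [this, le_div_iff₀ hk]
  linarith

omit hmax [Finite V] [DecidableEq V] [DecidableEq ι] in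
/-- An upper bound for half of the amortized costs of the requests in `K`, by the cost of a
facility at `c` that serves them. -/
noncomputable def clusterBound (c : V) (K : Finset ι) : ℝ :=
  harmonic K.card * I.openCost c + (1 + 2 * harmonic K.card) * ∑ i ∈ K, I.dist c (R i)

omit hmax [Finite V] [DecidableEq V] in
-- The slack is exactly `2 H_{k+1} d(c, R i)` with k = |K|; this is why the distances carry the
-- factor `1 + 2H`.
theorem clusterBound_insert {c : V} {K : Finset ι} {i : ι} (hi : i ∉ K) :
    I.clusterBound R c K + (I.dist c (R i) + I.openCost c / (K.card + 1) +
        2 * (∑ i ∈ K, I.dist c (R i)) / (K.card + 1)) ≤ I.clusterBound R c (insert i K) := by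
  have hH : (0 : ℝ) ≤ harmonic (K.card + 1) := by
    exact_mod_cast (harmonic_pos (Nat.succ_ne_zero _)).le
  have hd := mul_nonneg hH (I.dist_nonneg c (R i))
  unfold clusterBound
  rw [Finset.card_insert_of_notMem hi, Finset.sum_insert hi]
  have hs : ((harmonic (K.card + 1) : ℚ) : ℝ) = harmonic K.card + 1 / (K.card + 1) := by
    rw [harmonic_succ]; push_cast; simp
  have : (1 + 2 * (harmonic (K.card + 1) : ℝ)) * (I.dist c (R i) + ∑ i ∈ K, I.dist c (R i)) =
    I.dist c (R i) + 2 * (harmonic (K.card + 1) * I.dist c (R i)) +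
      (1 + 2 * (harmonic (K.card + 1) : ℝ)) * ∑ i ∈ K, I.dist c (R i) := by ring
  rw [this]
  have e : 2 * (∑ i ∈ K, I.dist c (R i)) / ((K.card : ℝ) + 1) =
    2 * (1 / ((K.card : ℝ) + 1)) * ∑ i ∈ K, I.dist c (R i) := by ring
  have e' : I.openCost c / ((K.card : ℝ) + 1) = 1 / ((K.card : ℝ) + 1) * I.openCost c := by ring
  nth_rewrite 1 [hs]
  nth_rewrite 2 [hs]
  rw [e, e']
  linarith

omit hmax [Finite V] [DecidableEq V] [DecidableEq ι] in
theorem clusterBound_le {c : V} {K : Finset ι} {N : ℕ} (hN : K.card ≤ N) :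
    I.clusterBound R c K ≤
      (1 + 2 * harmonic N) * (I.openCost c + ∑ i ∈ K, I.dist c (R i)) := by
  have hmono : ((harmonic K.card : ℚ) : ℝ) ≤ harmonic N := by
    have : harmonic K.card ≤ harmonic N :=
      Finset.sum_le_sum_of_subset_of_nonneg (Finset.range_subset_range.2 hN)
        fun _ _ _ => by positivity
    exact_mod_cast this
  have h0 : (0 : ℝ) ≤ harmonic N := by
    have : 0 ≤ harmonic N := Finset.sum_nonneg fun _ _ => by positivity
    exact_mod_cast this
  have hW : 0 ≤ ∑ i ∈ K, I.dist c (R i) := Finset.sum_nonneg fun i _ => I.dist_nonneg _ _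
  have hf := I.openCost_nonneg c
  unfold clusterBound
  nlinarith [mul_le_mul_of_nonneg_right hmono hf, mul_le_mul_of_nonneg_right hmono hW,
    mul_nonneg h0 hf]

/-- The requests in `U` are charged to the facilities `T` according to `σ`; all others are close
to a facility that costs nothing. -/
theorem amortSum_le_clusterBound {U : Finset ι} {T : Finset V} {σ : ι → V}
    (hσ : ∀ i ∈ U, σ i ∈ T) {e : ι → ℝ}
    (he : ∀ i, i ∉ U → ∃ v, I.openCost v = 0 ∧ I.dist v (R i) ≤ e i) {q : List ι}
    (hq : q.Nodup) :
    I.amortSum argmax (q.map R) ≤ 2 * (∑ i ∈ q.toFinset \ U, e i +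
      ∑ c ∈ T, I.clusterBound R c {i ∈ q.toFinset ∩ U | σ i = c}) := by
  induction q using List.reverseRecOn with
  | nil => simp [amortSum, amortSumFrom, clusterBound]
  | append_singleton q i ih =>
    have hq' : q.Nodup := (List.nodup_append.1 hq).1
    have hi : i ∉ q.toFinset := by
      intro h
      exact (List.nodup_append.1 hq).2.2 i (List.mem_toFinset.1 h) i (by simp) rfl
    specialize ih hq'
    rw [List.map_append, List.map_singleton, amortSum_append_singleton]
    have hins : (q ++ [i]).toFinset = insert i q.toFinset := by
      ext; simp
    rw [hins]
    by_cases hU : i ∈ U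
    · rw [Finset.insert_sdiff_of_mem _ hU, Finset.insert_inter_of_mem hU]
      have hK : ({j ∈ q.toFinset ∩ U | σ j = σ i} : Finset ι) ⊆ q.toFinset :=
        (Finset.filter_subset _ _).trans Finset.inter_subset_left
      have h1 := I.amortizedCost_runOnline_le_of_cluster hmax R hq' hK (R i) (σ i)
      -- Only the cluster of `σ i` changes when `i` arrives.
      have h2 : ∑ c ∈ T, I.clusterBound R c {j ∈ q.toFinset ∩ U | σ j = c} +
          (I.clusterBound R (σ i) {j ∈ insert i (q.toFinset ∩ U) | σ j = σ i} -
            I.clusterBound R (σ i) {j ∈ q.toFinset ∩ U | σ j = σ i}) =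
          ∑ c ∈ T, I.clusterBound R c {j ∈ insert i (q.toFinset ∩ U) | σ j = c} := by
        rw [← Finset.add_sum_erase _ _ (hσ i hU), ← Finset.add_sum_erase T (fun c =>
          I.clusterBound R c {j ∈ insert i (q.toFinset ∩ U) | σ j = c}) (hσ i hU)]
        have : ∀ c ∈ T.erase (σ i), I.clusterBound R c {j ∈ insert i (q.toFinset ∩ U) | σ j = c} =
            I.clusterBound R c {j ∈ q.toFinset ∩ U | σ j = c} := by
          intro c hc
          rw [Finset.filter_insert, if_neg (Finset.ne_of_mem_erase hc).symm]
        rw [Finset.sum_congr rfl this]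
        ring
      have h3 := I.clusterBound_insert R (c := σ i) (i := i)
        (K := {j ∈ q.toFinset ∩ U | σ j = σ i}) (fun h => hi (hK h))
      rw [← h2]
      rw [Finset.filter_insert, if_pos rfl]
      linarith
    · rw [Finset.insert_sdiff_of_notMem _ hU, Finset.insert_inter_of_notMem hU,
        Finset.sum_insert (by simp [hi])]
      obtain ⟨v, hv, hve⟩ := he i hU
      linarith [I.amortizedCost_runOnline_le hmax (q.map R) (R i) v]

/-- Every cluster has at most |U| ≤ N members, so one factor serves all clusters. Only requests in
`U` enter the harmonic number, which is where a good prediction helps. -/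
theorem amortSum_le_harmonic [Fintype ι] {U : Finset ι} {T : Finset V} {σ : ι → V}
    (hσ : ∀ i ∈ U, σ i ∈ T) {e : ι → ℝ} (he0 : ∀ i ∉ U, 0 ≤ e i)
    (he : ∀ i, i ∉ U → ∃ v, I.openCost v = 0 ∧ I.dist v (R i) ≤ e i) {q : List ι}
    (hq : q.Nodup) {N : ℕ} (hN : U.card ≤ N) :
    I.amortSum argmax (q.map R) ≤ 2 * (∑ i ∈ Uᶜ, e i +
      (1 + 2 * harmonic N) * (∑ c ∈ T, I.openCost c + ∑ i, I.dist (σ i) (R i))) := by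
  have h0 : (0 : ℝ) ≤ harmonic N := by
    have : 0 ≤ harmonic N := Finset.sum_nonneg fun _ _ => by positivity
    exact_mod_cast this
  have h1 := I.amortSum_le_clusterBound hmax R hσ he hq
  have h2 : ∑ i ∈ q.toFinset \ U, e i ≤ ∑ i ∈ Uᶜ, e i :=
    Finset.sum_le_sum_of_subset_of_nonneg (fun i => by simp)
      fun i hi _ => he0 i (by simpa using hi)
  have h3 : ∑ c ∈ T, I.clusterBound R c {i ∈ q.toFinset ∩ U | σ i = c} ≤
      ∑ c ∈ T, (1 + 2 * harmonic N) *
        (I.openCost c + ∑ i ∈ q.toFinset ∩ U with σ i = c, I.dist (σ i) (R i)) := by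
    refine Finset.sum_le_sum fun c _ => (I.clusterBound_le R (N := N) ?_).trans_eq ?_
    · exact (Finset.card_le_card ((Finset.filter_subset _ _).trans
        Finset.inter_subset_right)).trans hN
    · congr 2
      exact Finset.sum_congr rfl fun i hi => by rw [(Finset.mem_filter.1 hi).2]
  rw [← Finset.mul_sum, Finset.sum_add_distrib, Finset.sum_fiberwise_of_maps_to
    (fun i hi => hσ i (Finset.mem_inter.1 hi).2)] at h3
  have h4 : ∑ i ∈ q.toFinset ∩ U, I.dist (σ i) (R i) ≤ ∑ i, I.dist (σ i) (R i) :=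
    Finset.sum_le_sum_of_subset_of_nonneg (Finset.subset_univ _)
      fun i _ _ => I.dist_nonneg _ _
  have h5 := mul_le_mul_of_nonneg_left (add_le_add_right h4 (∑ c ∈ T, I.openCost c))
    (by linarith : (0 : ℝ) ≤ 1 + 2 * harmonic N)
  linarith

end Run

end Instance

/-! ### Prize-collecting solutions and the subroutine `Partial`. -/

namespace Solution

theorem mem_unserved {V : Type*} {m : ℕ} {S : Solution V m} {j : Fin m} :
    j ∈ S.unserved ↔ S.assign j = none := by
  simp [unserved]

theorem unserved_empty {V : Type*} {m : ℕ} : (Solution.empty V m).unserved = Finset.univ := by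
  ext; simp [mem_unserved, empty]

instance {V : Type*} [Finite V] {m : ℕ} : Finite (Solution V m) :=
  Finite.of_injective (fun S : Solution V m => (S.opened, S.assign)) fun S T h => by
    cases S; cases T; simp_all

end Solution

namespace Instance

section Partial

variable {V : Type*} (I : Instance V) {m : ℕ} (req : Fin m → V)

theorem elim_dist_nonneg (o : Option V) (r : V) : 0 ≤ o.elim 0 fun v => I.dist v r := by
  cases o with
  | none => exact le_rfl
  | some v => exact I.dist_nonneg v r

theorem cost_nonneg (S : Solution V m) : 0 ≤ I.cost req S :=
  add_nonneg (Finset.sum_nonneg fun v _ => I.openCost_nonneg v)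
    (Finset.sum_nonneg fun _ _ => I.elim_dist_nonneg _ _)

theorem openCost_sum_le_cost (S : Solution V m) :
    ∑ v ∈ S.opened, I.openCost v ≤ I.cost req S :=
  le_add_of_nonneg_right (Finset.sum_nonneg fun _ _ => I.elim_dist_nonneg _ _)

theorem cost_empty : I.cost req (Solution.empty V m) = 0 := by
  simp [cost, Solution.empty]

/-- The solution that opens `v` only and connects everything to it. -/
def singleSol (v : V) (m : ℕ) : Solution V m where
  opened := {v}
  assign := fun _ => some v
  assign_mem := by simp

theorem singleSol_unserved (v : V) : (singleSol v m).unserved = ∅ := by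
  ext; simp [Solution.mem_unserved, singleSol]

variable {I req} {γ : ℝ} {PC : (Fin m → ℝ) → Solution V m}

theorem IsPrizeCollectingApprox.const_le (hPC : I.IsPrizeCollectingApprox γ req PC) {x : ℝ}
    (hx : 0 < x) (T : Solution V m) :
    I.cost req (PC fun _ => x) + (PC fun _ => x).unserved.card * x ≤
      γ * (I.cost req T + T.unserved.card * x) := by
  simpa [prizeCost] using hPC (fun _ => x) (fun _ => hx) T

/-- A penalty above `γ` times the cost of serving everything from one vertex forces every request to
be satisfied. -/
theorem IsPrizeCollectingApprox.goodExponents_nonempty [Nonempty V]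
    (hPC : I.IsPrizeCollectingApprox γ req PC) (hγ : 1 ≤ γ) (u : ℕ) :
    (goodExponents γ PC u).Nonempty := by
  obtain ⟨v⟩ := ‹Nonempty V›
  obtain ⟨k, hk⟩ := pow_unbounded_of_one_lt (γ * I.cost req (singleSol v m)) one_lt_two
  refine ⟨k, ?_⟩
  have hx : (0 : ℝ) < 2 ^ (k : ℤ) := by positivity
  have h := hPC.const_le hx (singleSol v m)
  rw [singleSol_unserved] at h
  have h0 := I.cost_nonneg req (PC fun _ => (2 : ℝ) ^ (k : ℤ))
  have hlt : ((PC fun _ => (2 : ℝ) ^ (k : ℤ)).unserved.card : ℝ) < 1 := by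
    by_contra! hge
    have := mul_le_mul_of_nonneg_right hge hx.le
    simp only [Finset.card_empty, Nat.cast_zero, zero_mul, add_zero, one_mul, zpow_natCast]
      at h this h0
    linarith
  have : (PC fun _ => (2 : ℝ) ^ (k : ℤ)).unserved.card = 0 := by
    have : (PC fun _ => (2 : ℝ) ^ (k : ℤ)).unserved.card < 1 := by exact_mod_cast hlt
    omega
  change ((PC fun _ => (2 : ℝ) ^ (k : ℤ)).unserved.card : ℝ) ≤ γ * u
  rw [this, Nat.cast_zero]
  positivity

/-- Compared with the empty solution, `PC` costs at most `γ m 2 ^ i`. There are finitely many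
solutions, so nonzero costs are bounded away from 0, and a small enough `i` leaves only cost 0. -/
theorem IsPrizeCollectingApprox.exists_cost_eq_zero [Finite V]
    (hPC : I.IsPrizeCollectingApprox γ req PC) (hγ : 1 ≤ γ) {s : Set ℤ} (hs : ¬ BddBelow s) :
    ∃ i ∈ s, I.cost req (PC fun _ => (2 : ℝ) ^ i) = 0 := by
  by_contra! hne
  have hpos : ∃ ε > 0, ∀ S : Solution V m, I.cost req S ≠ 0 → ε ≤ I.cost req S := by
    rcases isEmpty_or_nonempty {S : Solution V m // I.cost req S ≠ 0} with h | h
    · exact ⟨1, one_pos, fun S hS => (h.false ⟨S, hS⟩).elim⟩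
    · obtain ⟨S, hS⟩ := Finite.exists_min
        fun S : {S : Solution V m // I.cost req S ≠ 0} => I.cost req S.1
      exact ⟨I.cost req S.1, lt_of_le_of_ne (I.cost_nonneg req _) S.2.symm,
        fun T hT => hS ⟨T, hT⟩⟩
  obtain ⟨ε, hε, hmin⟩ := hpos
  obtain ⟨k, hk⟩ := pow_unbounded_of_one_lt (γ * m / ε) one_lt_two
  obtain ⟨i, his, hik⟩ := not_bddBelow_iff.1 hs (-(k : ℤ))
  have hx : (0 : ℝ) < 2 ^ i := by positivity
  have h1 := hPC.const_le hx (Solution.empty V m)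
  rw [I.cost_empty, Solution.unserved_empty, Finset.card_univ, Fintype.card_fin, zero_add] at h1
  have h2 := hmin _ (hne i his)
  have h3 : (2 : ℝ) ^ i ≤ (2 ^ k)⁻¹ := by
    rw [← zpow_natCast, ← zpow_neg]
    exact zpow_le_zpow_right₀ one_le_two hik.le
  have h4 : (0 : ℝ) ≤ (PC fun _ => (2 : ℝ) ^ i).unserved.card * 2 ^ i := by positivity
  have h5 : γ * m * (2 : ℝ) ^ i ≤ γ * m * (2 ^ k)⁻¹ :=
    mul_le_mul_of_nonneg_left h3 (by positivity)
  have h6 : γ * m * ((2 : ℝ) ^ k)⁻¹ < ε := by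
    rw [← div_eq_mul_inv, div_lt_iff₀ (by positivity)]
    rw [div_lt_iff₀ hε] at hk
    linarith
  linarith

theorem not_bddBelow_int_of_forall_not_isLeast {s : Set ℤ} (hs : s.Nonempty)
    (h : ¬ ∃ i, IsLeast s i) : ¬ BddBelow s := fun hb =>
  h ⟨sInf s, Int.csInf_mem hs hb, fun _ hx => csInf_le hb hx⟩

/-- `Partial` with allowance `u` leaves at most `2 γ u` requests unsatisfied. -/
theorem partialSol_unserved_card_le [Finite V] [Nonempty V]
    (hPC : I.IsPrizeCollectingApprox γ req PC) (hγ : 1 ≤ γ) (u : ℕ) :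
    ((I.partialSol γ req PC u).unserved.card : ℝ) ≤ 2 * γ * u := by
  have h0 : 0 ≤ γ * u := by positivity
  unfold partialSol
  split_ifs with h1 h2
  · rw [Solution.unserved_empty, Finset.card_univ, Fintype.card_fin]
    linarith
  · dsimp only
    have hc : ((PC fun _ => (2 : ℝ) ^ h2.choose).unserved.card : ℝ) ≤ γ * u := h2.choose_spec.1
    -- `S₁` is returned only if `u₁ + u₂ ≤ 2γu`, hence `u₁ ≤ 2γu`.
    split_ifs with h3
    · have : (0 : ℝ) ≤ (PC fun _ => (2 : ℝ) ^ h2.choose).unserved.card := by positivity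
      linarith
    · linarith
  · have hs := not_bddBelow_int_of_forall_not_isLeast (hPC.goodExponents_nonempty hγ u) h2
    refine le_trans (Classical.epsilon_spec (hPC.exists_cost_eq_zero hγ hs)).1 ?_
    linarith

/-- `Partial` with allowance `u` costs at most `3 γ` times as much as any solution that leaves at
most `u` requests unsatisfied. -/
theorem cost_partialSol_le [Finite V] [Nonempty V]
    (hPC : I.IsPrizeCollectingApprox γ req PC) (hγ : 1 ≤ γ) {u : ℕ} {T : Solution V m}
    (hT : T.unserved.card ≤ u) :
    I.cost req (I.partialSol γ req PC u) ≤ 3 * γ * I.cost req T := by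
  have hT0 : 0 ≤ γ * I.cost req T := mul_nonneg (by linarith) (I.cost_nonneg req T)
  unfold partialSol
  split_ifs with h1 h2
  · rw [I.cost_empty]; linarith
  · dsimp only
    have hbad : γ * u < ((PC fun _ => (2 : ℝ) ^ (h2.choose - 1)).unserved.card : ℝ) := by
      by_contra! h
      have := h2.choose_spec.2 h
      linarith
    have hx : (0 : ℝ) < 2 ^ (h2.choose - 1) := by positivity
    have hxx : (2 : ℝ) ^ h2.choose = 2 * 2 ^ (h2.choose - 1) := by
      rw [← zpow_one_add₀ two_ne_zero]; congr 1; ring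
    have a1 := hPC.const_le hx T
    have a2 := hPC.const_le (by positivity : (0 : ℝ) < 2 ^ h2.choose) T
    have hTu : (T.unserved.card : ℝ) ≤ u := by exact_mod_cast hT
    set S₁ := PC fun _ => (2 : ℝ) ^ (h2.choose - 1)
    set S₂ := PC fun _ => (2 : ℝ) ^ h2.choose
    rw [hxx] at a2
    set x := (2 : ℝ) ^ (h2.choose - 1)
    have hc1 := I.cost_nonneg req S₁
    have b0 : γ * (T.unserved.card * x) ≤ γ * (u * x) := by gcongr
    -- Since `u₁ > γu`, this bounds both the cost of `S₁` and `(u₁ - γu)x` by `γ c(T)`. If `S₂` is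
    -- returned, then `γu - u₂ < u₁ - γu`, so the extra term in `b2` is at most `2γ c(T)`; hence the
    -- factor 3.
    have b1 : I.cost req S₁ + (S₁.unserved.card - γ * u) * x ≤ γ * I.cost req T := by linarith
    have b2 : I.cost req S₂ ≤ γ * I.cost req T + 2 * ((γ * u - S₂.unserved.card) * x) := by
      linarith
    split_ifs with h3
    · have := mul_nonneg (sub_nonneg.2 hbad.le) hx.le
      linarith
    · have : (γ * u - S₂.unserved.card) * x ≤ (S₁.unserved.card - γ * u) * x :=
        mul_le_mul_of_nonneg_right (by linarith) hx.le
      linarith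
  · have hs := not_bddBelow_int_of_forall_not_isLeast (hPC.goodExponents_nonempty hγ u) h2
    rw [(Classical.epsilon_spec (hPC.exists_cost_eq_zero hγ hs)).2]
    linarith

theorem boughtSol_eq_partialSol (hγ : 1 ≤ γ) {x : ℝ} (hx : 0 ≤ x) :
    ∃ u, I.boughtSol γ req PC x = I.partialSol γ req PC u ∧
      I.cost req (I.partialSol γ req PC u) ≤ 3 * γ * x ∧
      ∀ u' ≤ m, I.cost req (I.partialSol γ req PC u') ≤ 3 * γ * x → u ≤ u' := by
  have hne : {u : ℕ | u ≤ m ∧ I.cost req (I.partialSol γ req PC u) ≤ 3 * γ * x}.Nonempty := by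
    -- Allowance `m` always qualifies: as `γ ≥ 1`, `Partial` then returns the empty solution.
    refine ⟨m, le_rfl, ?_⟩
    rw [partialSol, if_pos (le_mul_of_one_le_left (by positivity) hγ), I.cost_empty]
    positivity
  exact ⟨_, rfl, (Nat.sInf_mem hne).2, fun u' h h' => Nat.sInf_le ⟨h, h'⟩⟩

end Partial

/-! ### Moving an offline solution along the matching. -/

section Transfer

variable {V : Type*} {I : Instance V} {n m : ℕ} {R : Fin n → V} {Rhat : Fin m → V}

theorem exists_assign_of_unserved_eq_empty {T : Solution V n} (hT : T.unserved = ∅) :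
    ∃ σ : Fin n → V, (∀ i, T.assign i = some (σ i)) ∧ (∀ i, σ i ∈ T.opened) ∧
      I.cost R T = ∑ v ∈ T.opened, I.openCost v + ∑ i, I.dist (σ i) (R i) := by
  have h : ∀ i, ∃ v, T.assign i = some v := fun i => by
    rw [← Option.ne_none_iff_exists']
    intro hn
    have := Solution.mem_unserved.2 hn
    simp [hT] at this
  choose σ hσ using h
  exact ⟨σ, hσ, fun i => T.assign_mem i _ (hσ i), by simp [cost, hσ]⟩

/-- A solution for the requests yields one for the matched predictions. -/
theorem exists_solution_of_matching {T : Solution V n} (hT : T.unserved = ∅)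
    {A : Finset (Fin n)} {B : Finset (Fin m)} (e : {i // i ∈ A} ≃ {j // j ∈ B}) :
    ∃ S : Solution V m, S.unserved.card ≤ Bᶜ.card ∧
      I.cost Rhat S ≤ I.cost R T + ∑ i, I.dist (R i.1) (Rhat (e i).1) := by
  obtain ⟨σ, -, hmem, hcost⟩ := exists_assign_of_unserved_eq_empty (I := I) (R := R) hT
  -- Each matched prediction uses the facility of its partner request.
  refine ⟨⟨T.opened, fun j => if h : j ∈ B then some (σ (e.symm ⟨j, h⟩)) else none, ?_⟩, ?_, ?_⟩
  · intro j v h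
    split_ifs at h
    cases h
    exact hmem _
  · refine Finset.card_le_card fun j hj => ?_
    rw [Solution.mem_unserved] at hj
    rw [Finset.mem_compl]
    intro h
    simp [h] at hj
  · rw [hcost, cost, add_assoc]
    refine add_le_add_right ?_ _
    have h1 : ∑ j : Fin m, ((if h : j ∈ B then some (σ (e.symm ⟨j, h⟩)) else none : Option V).elim
        0 fun v => I.dist v (Rhat j)) = ∑ i : {i // i ∈ A}, I.dist (σ i) (Rhat (e i).1) := by
      rw [← Finset.sum_subset (Finset.subset_univ B) (fun j _ hj => by simp [hj]),
        ← Finset.sum_coe_sort B, ← e.sum_comp]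
      refine Finset.sum_congr rfl fun i _ => ?_
      simp
    have h2 : ∑ i : {i // i ∈ A}, I.dist (σ i) (R i) ≤ ∑ i, I.dist (σ i) (R i) := by
      rw [Finset.sum_coe_sort A fun i => I.dist (σ i) (R i)]
      exact Finset.sum_le_sum_of_subset_of_nonneg (Finset.subset_univ _)
        fun i _ _ => I.dist_nonneg _ _
    have h3 : ∑ i : {i // i ∈ A}, I.dist (σ i) (Rhat (e i).1) ≤
        ∑ i : {i // i ∈ A}, (I.dist (σ i) (R i) + I.dist (R i) (Rhat (e i).1)) :=
      Finset.sum_le_sum fun i _ => I.dist_triangle _ _ _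
    rw [Finset.sum_add_distrib] at h3
    dsimp only
    rw [h1]
    linarith

end Transfer

/-! ### Phases of the framework and the doubling argument. -/

section Framework

variable {V : Type*} [DecidableEq V] (I : Instance V)

theorem withFree_openCost_le (S : Finset V) (v : V) :
    (I.withFree S).openCost v ≤ I.openCost v := by
  change (if v ∈ S then 0 else I.openCost v) ≤ I.openCost v
  split_ifs
  · exact I.openCost_nonneg v
  · exact le_rfl

theorem withFree_openCost_of_mem {S : Finset V} {v : V} (hv : v ∈ S) :
    (I.withFree S).openCost v = 0 :=
  if_pos hv

theorem sum_openCost_union_le (S F : Finset V) :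
    ∑ v ∈ S ∪ F, I.openCost v ≤
      ∑ v ∈ S, I.openCost v + ∑ v ∈ F, (I.withFree S).openCost v := by
  rw [← Finset.union_sdiff_self_eq_union, Finset.sum_union Finset.disjoint_sdiff]
  refine add_le_add_right ?_ _
  calc ∑ v ∈ F \ S, I.openCost v = ∑ v ∈ F \ S, (I.withFree S).openCost v :=
        Finset.sum_congr rfl fun v hv => (if_neg (Finset.mem_sdiff.1 hv).2).symm
    _ ≤ _ := Finset.sum_le_sum_of_subset_of_nonneg Finset.sdiff_subset
        fun v _ _ => (I.withFree S).openCost_nonneg v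

variable (argmax : (V → ℝ) → V) (γ : ℝ) {n m : ℕ} (R : Fin n → V)

/-- The invariants of the framework, where `q` lists the requests served in the current phase.
Here `Q` is the value of `Bhat` from which on the open facilities satisfy `Rich`, and `X` bounds
the amortized cost of a phase from then on. -/
structure FrameworkInv (Rich : Finset V → Prop) (Q X : ℝ) (s : FrameworkState V)
    (q : List (Fin n)) : Prop where
  online_eq : s.online = (I.withFree s.S₀).runOnline argmax (q.map R)
  B_eq : s.B = s.Bhat + (I.withFree s.S₀).amortSum argmax (q.map R)
  S_eq : s.S = s.S₀ ∪ s.online.F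
  Bhat_nonneg : 0 ≤ s.Bhat
  B_le : s.B ≤ 2 * s.Bhat
  cost_le : 2 * (∑ v ∈ s.S₀, I.openCost v + s.connCost) ≤
    2 * (s.Bhat + 6 * γ * s.Bhat) + (I.withFree s.S₀).amortSum argmax (q.map R)
  phase : s.Bhat ≤ Q ∨ Rich s.S₀ ∧ s.Bhat ≤ 4 * Q + 2 * X

variable {I argmax γ R} {Rhat : Fin m → V} {PC : (Fin m → ℝ) → Solution V m}
  {Rich : Finset V → Prop} {Q X : ℝ}

theorem frameworkInv_init (hQ : 0 ≤ Q) :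
    I.FrameworkInv argmax γ R Rich Q X (FrameworkState.init V) [] where
  online_eq := rfl
  B_eq := by simp [FrameworkState.init, amortSum, amortSumFrom]
  S_eq := by simp [FrameworkState.init, OnlineState.init]
  Bhat_nonneg := le_rfl
  B_le := by simp [FrameworkState.init]
  cost_le := by simp [FrameworkState.init, amortSum, amortSumFrom]
  phase := Or.inl hQ

variable (hmax : ∀ (g : V → ℝ) (v : V), g v ≤ g (argmax g)) (hγ : 1 ≤ γ)
  (hQ : 0 ≤ Q) (hX : 0 ≤ X) (hmono : ∀ S S', S ⊆ S' → Rich S → Rich S')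
  (hbuy : ∀ x, Q ≤ x → x ≤ 4 * Q → Rich (I.boughtSol γ Rhat PC x).opened)
  (hstep : ∀ S₀ l i, (I.withFree S₀).amortizedCost
    ((I.withFree S₀).runOnline argmax l) (R i) ≤ 2 * Q)
  (hrich : ∀ S₀, Rich S₀ → ∀ q : List (Fin n), q.Nodup →
    (I.withFree S₀).amortSum argmax (q.map R) ≤ X)
include hmax hγ hQ hX hmono hbuy hstep hrich

/-- Either the phase continues with `i` appended, or it ends and the list of current requests is
emptied. In the first case only the connection cost grows, by at most half of the amortized cost. -/
theorem FrameworkInv.step {s : FrameworkState V} {q : List (Fin n)} {i : Fin n}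
    (hs : I.FrameworkInv argmax γ R Rich Q X s q) (hq : (q ++ [i]).Nodup) :
    I.FrameworkInv argmax γ R Rich Q X (I.frameworkStep argmax γ Rhat PC s (R i)) (q ++ [i]) ∨
    I.FrameworkInv argmax γ R Rich Q X (I.frameworkStep argmax γ Rhat PC s (R i)) [] := by
  set J := I.withFree s.S₀ with hJ
  have hon : J.onlineStep argmax s.online (R i) = J.runOnline argmax ((q ++ [i]).map R) := by
    rw [hs.online_eq, List.map_append, List.map_singleton, runOnline_append_singleton]
  have ham : J.amortSum argmax ((q ++ [i]).map R) =
      J.amortSum argmax (q.map R) + J.amortizedCost s.online (R i) := by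
    rw [hs.online_eq, List.map_append, List.map_singleton, amortSum_append_singleton]
  have hspec : J.StepSpec s.online (J.onlineStep argmax s.online (R i)) (R i) :=
    J.onlineStep_spec hmax (by
      rw [hs.online_eq]; exact (J.runOnline_valid_and_seen hmax _).1) (R i)
  have hcl : J.amortizedCost s.online (R i) ≤ 2 * Q := by
    rw [hs.online_eq]; exact hstep _ _ _
  have hsum0 := J.amortSum_nonneg hmax (q.map R)
  have hBeq : s.B + J.amortizedCost s.online (R i) =
      s.Bhat + J.amortSum argmax ((q ++ [i]).map R) := by rw [ham, hs.B_eq]; ring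
  have hsum1 := J.amortSum_nonneg hmax ((q ++ [i]).map R)
  have hB0 : 0 ≤ s.B + J.amortizedCost s.online (R i) := by rw [hBeq]; linarith [hs.Bhat_nonneg]
  have hS : s.S ∪ (J.onlineStep argmax s.online (R i)).F =
      s.S₀ ∪ (J.onlineStep argmax s.online (R i)).F := by
    rw [hs.S_eq, Finset.union_assoc, Finset.union_eq_right.2 hspec.subset]
  have hconn : 2 * I.distTo (s.S ∪ (J.onlineStep argmax s.online (R i)).F) (R i) ≤
      J.amortizedCost s.online (R i) := by
    have h := I.distTo_anti hspec.nonempty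
      (Finset.subset_union_right (s₁ := s.S)) (R i)
    have h' : 2 * I.distTo (J.onlineStep argmax s.online (R i)).F (R i) ≤
      J.amortizedCost s.online (R i) := hspec.conn_le
    linarith
  have hopen := J.runOnline_openCost_le hmax ((q ++ [i]).map R)
  rw [← hon] at hopen
  have hcost := hs.cost_le
  rw [← hJ] at hcost
  unfold frameworkStep
  simp only [← hJ]
  split_ifs with hB
  · right
    set S' := (s.S ∪ (J.onlineStep argmax s.online (R i)).F) with hS'
    set B' := s.B + J.amortizedCost s.online (R i) with hB'
    obtain ⟨u, hu, huc, -⟩ := I.boughtSol_eq_partialSol (req := Rhat) (PC := PC) hγ hB0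
    refine ⟨rfl, by simp [amortSum, amortSumFrom], by simp [OnlineState.init], hB0,
      by simp only; linarith, ?_, ?_⟩
    · have h1 : ∑ v ∈ S' ∪ (I.boughtSol γ Rhat PC B').opened, I.openCost v ≤
          ∑ v ∈ S', I.openCost v + ∑ v ∈ (I.boughtSol γ Rhat PC B').opened, I.openCost v := by
        rw [← Finset.sum_union_inter]
        linarith [Finset.sum_nonneg fun v (_ : v ∈ S' ∩ (I.boughtSol γ Rhat PC B').opened) =>
          I.openCost_nonneg v]
      have h2 := I.openCost_sum_le_cost Rhat (I.boughtSol γ Rhat PC B')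
      rw [← hu] at huc
      have h3 := I.sum_openCost_union_le s.S₀ (J.onlineStep argmax s.online (R i)).F
      rw [← hS] at h3
      -- Geometric sum: earlier purchases, at most `6γ Bhat ≤ 3γB'`, plus the new one, at most
      -- `3γB'`, stay within `6γB'`.
      have h4 : 6 * γ * s.Bhat ≤ 3 * γ * B' := by
        have := mul_le_mul_of_nonneg_left hB (by linarith : 0 ≤ 3 * γ)
        linarith
      simp only [amortSum, amortSumFrom, List.map_nil]
      linarith
    · simp only
      -- If `s.Bhat ≤ Q`, then `B' ≤ 2 * s.Bhat + 2Q ≤ 4Q`. Otherwise the ending phase has amortized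
      -- cost at least `s.Bhat` and at most `X`, so `B' ≤ 2X`.
      rcases hs.phase with h | ⟨hr, h⟩
      · rcases le_total B' Q with hlt | hge
        · exact Or.inl hlt
        · refine Or.inr ⟨hmono _ _ Finset.subset_union_right (hbuy B' hge ?_), ?_⟩ <;>
            linarith [hs.B_le]
      · refine Or.inr ⟨hmono _ _ ((hS ▸ Finset.subset_union_left : s.S₀ ⊆ S').trans
          Finset.subset_union_left) hr, ?_⟩
        have := hrich _ hr _ hq
        rw [← hJ] at this
        linarith
  · left
    refine ⟨hon, hBeq, hS, hs.Bhat_nonneg, (not_le.1 hB).le, ?_, hs.phase⟩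
    simp only
    rw [← hJ]
    linarith

theorem frameworkInv_foldl {l : List (Fin n)} (hl : l.Nodup) :
    ∃ p q, l = p ++ q ∧ I.FrameworkInv argmax γ R Rich Q X
      ((l.map R).foldl (I.frameworkStep argmax γ Rhat PC) (FrameworkState.init V)) q := by
  induction l using List.reverseRecOn with
  | nil => exact ⟨[], [], rfl, frameworkInv_init hQ⟩
  | append_singleton l i ih =>
    obtain ⟨p, q, rfl, h⟩ := ih (List.nodup_append.1 hl).1
    rw [List.map_append, List.foldl_append]
    rw [List.append_assoc] at hl ⊢
    rcases h.step hmax hγ hQ hX hmono hbuy hstep hrich (i := i) (List.nodup_append.1 hl).2.1 with h | h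
    · exact ⟨p, q ++ [i], rfl, h⟩
    · exact ⟨p ++ (q ++ [i]), [], by simp, h⟩

theorem algCost_le_of_phases :
    I.algCost argmax γ R Rhat PC ≤ 8 * γ * (4 * Q + 2 * X) := by
  have hfin : I.finalState argmax γ R Rhat PC = ((List.finRange n).map R).foldl
      (I.frameworkStep argmax γ Rhat PC) (FrameworkState.init V) := by
    rw [finalState, List.ofFn_eq_map]
  obtain ⟨p, q, -, h⟩ := frameworkInv_foldl hmax hγ hQ hX hmono hbuy hstep hrich
    (List.nodup_finRange n)
  rw [← hfin] at h
  rw [algCost]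
  set s := I.finalState argmax γ R Rhat PC
  have h1 := I.sum_openCost_union_le s.S₀ s.online.F
  rw [← h.S_eq] at h1
  have h2 := (I.withFree s.S₀).runOnline_openCost_le hmax (q.map R)
  rw [← h.online_eq] at h2
  have h3 : s.Bhat ≤ 4 * Q + 2 * X := by
    rcases h.phase with hp | hp
    · linarith
    · exact hp.2
  have h4 : ∑ v ∈ s.S, I.openCost v + s.connCost ≤ 2 * s.Bhat + 6 * γ * s.Bhat := by
    linarith [h.cost_le, h.B_eq, h.B_le]
  have h5 : 2 * s.Bhat ≤ 2 * γ * s.Bhat :=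
    mul_le_mul_of_nonneg_right (by linarith) h.Bhat_nonneg
  have h6 := mul_le_mul_of_nonneg_left h3 (by linarith : 0 ≤ 8 * γ)
  linarith

end Framework

/-! ### Combining the prediction with the online bound. -/

section Main

variable {V : Type*} [DecidableEq V] [Finite V] {I : Instance V} {argmax : (V → ℝ) → V}
  {γ : ℝ} {n m : ℕ} {R : Fin n → V} {Rhat : Fin m → V} {PC : (Fin m → ℝ) → Solution V m}

omit [DecidableEq V] [Finite V] in
-- Such a request is either outside `A` or injects into the unsatisfied predictions through the
-- matching.
theorem card_unmatched_le {A : Finset (Fin n)} {B : Finset (Fin m)}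
    (e : {i // i ∈ A} ≃ {j // j ∈ B}) (P : Solution V m) :
    (Finset.univ.filter fun i : Fin n => ∀ h : i ∈ A, P.assign (e ⟨i, h⟩) = none).card ≤
      Aᶜ.card + P.unserved.card := by
  classical
  have h1 : (Finset.univ.filter fun i : Fin n => ∀ h : i ∈ A, P.assign (e ⟨i, h⟩) = none) ⊆
      Aᶜ ∪ (Finset.univ.filter fun i : {i // i ∈ A} => P.assign (e i) = none).image
        Subtype.val := by
    intro i hi
    rw [Finset.mem_filter] at hi
    by_cases h : i ∈ A
    · refine Finset.mem_union_right _ (Finset.mem_image.2 ⟨⟨i, h⟩, ?_, rfl⟩)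
      simpa using hi.2 h
    · exact Finset.mem_union_left _ (Finset.mem_compl.2 h)
  have h2 : (Finset.univ.filter fun i : {i // i ∈ A} => P.assign (e i) = none).card ≤
      P.unserved.card := by
    refine Finset.card_le_card_of_injOn (fun i => (e i).1) (fun i hi => ?_) ?_
    · exact Finset.mem_coe.2 (Solution.mem_unserved.2 (by simpa using hi))
    · intro i _ j _ h
      exact e.injective (Subtype.ext h)
  exact (Finset.card_le_card h1).trans ((Finset.card_union_le _ _).trans
    (add_le_add_right (Finset.card_image_le.trans h2) _))

/-- The amortized cost of a phase in which the facilities of `P` are free. -/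
theorem amortSum_withFree_le (hmax : ∀ (g : V → ℝ) (v : V), g v ≤ g (argmax g))
    {T : Solution V n} (hT : T.unserved = ∅) {A : Finset (Fin n)} {B : Finset (Fin m)}
    (e : {i // i ∈ A} ≃ {j // j ∈ B}) (P : Solution V m) {S₀ : Finset V} (hP : P.opened ⊆ S₀)
    {N : ℕ} (hn : n ≤ N ∨ Aᶜ.card + P.unserved.card ≤ N) {q : List (Fin n)} (hq : q.Nodup) :
    (I.withFree S₀).amortSum argmax (q.map R) ≤
      2 * (∑ i, I.dist (R i.1) (Rhat (e i).1) + I.cost Rhat P +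
        (1 + 2 * harmonic N) * I.cost R T) := by
  obtain ⟨σ, -, hmem, hcost⟩ := exists_assign_of_unserved_eq_empty (I := I) (R := R) hT
  set U : Finset (Fin n) :=
    Finset.univ.filter fun i : Fin n => ∀ h : i ∈ A, P.assign (e ⟨i, h⟩) = none with hU
  have hUN : U.card ≤ N := by
    rcases hn with h | h
    · exact (Finset.card_le_univ U).trans (by simpa using h)
    · exact (card_unmatched_le e P).trans h
  -- Detour from a request through its matched prediction to the facility that `P` assigns to it;
  -- these sum to at most `D + cost(P)`.
  let c : {i // i ∈ A} → ℝ := fun i => I.dist (R i.1) (Rhat (e i).1) +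
    (P.assign (e i)).elim 0 fun v => I.dist v (Rhat (e i).1)
  have hc : ∀ i, 0 ≤ c i := fun i => add_nonneg (I.dist_nonneg _ _) (I.elim_dist_nonneg _ _)
  let d : Fin n → ℝ := fun i => if h : i ∈ A then c ⟨i, h⟩ else 0
  have hd0 : ∀ i, 0 ≤ d i := fun i => by
    by_cases h : i ∈ A
    · simpa [d, h] using hc ⟨i, h⟩
    · simp [d, h]
  have hd : ∑ i ∈ Uᶜ, d i ≤ ∑ i, I.dist (R i.1) (Rhat (e i).1) + I.cost Rhat P := by
    calc ∑ i ∈ Uᶜ, d i ≤ ∑ i, d i :=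
          Finset.sum_le_sum_of_subset_of_nonneg (Finset.subset_univ _) fun i _ _ => hd0 i
      _ = ∑ i : {i // i ∈ A}, c i := by
          rw [← Finset.sum_subset (Finset.subset_univ A) (fun i _ hi => by simp [d, hi]),
            ← Finset.sum_coe_sort A]
          exact Finset.sum_congr rfl fun i _ => by simp [d]
      _ ≤ _ := by
          rw [Finset.sum_add_distrib,
            e.sum_comp fun j => (P.assign j).elim 0 fun v => I.dist v (Rhat j.1),
            Finset.sum_coe_sort B fun j => (P.assign j).elim 0 fun v => I.dist v (Rhat j)]
          refine add_le_add_right (le_trans (Finset.sum_le_sum_of_subset_of_nonneg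
            (Finset.subset_univ _) fun j _ _ => I.elim_dist_nonneg _ _) ?_) _
          exact le_add_of_nonneg_left (Finset.sum_nonneg fun v _ => I.openCost_nonneg v)
  have hfree : ∀ i, i ∉ U →
      ∃ v, (I.withFree S₀).openCost v = 0 ∧ (I.withFree S₀).dist v (R i) ≤ d i := by
    intro i hi
    simp only [hU, Finset.mem_filter, Finset.mem_univ, true_and, not_forall] at hi
    obtain ⟨h, hne⟩ := hi
    obtain ⟨v, hv⟩ := Option.ne_none_iff_exists'.1 hne
    refine ⟨v, I.withFree_openCost_of_mem (hP (P.assign_mem _ v hv)), ?_⟩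
    change I.dist v (R i) ≤ d i
    simp only [d, c, h, dif_pos, hv, Option.elim_some]
    rw [I.dist_comm (R i), add_comm]
    exact I.dist_triangle _ _ _
  have h := (I.withFree S₀).amortSum_le_harmonic hmax R (U := U) (T := T.opened) (σ := σ)
    (fun i _ => hmem i) (e := d) (fun i _ => hd0 i) hfree hq hUN
  have hle : ∑ v ∈ T.opened, (I.withFree S₀).openCost v +
      ∑ i, (I.withFree S₀).dist (σ i) (R i) ≤ I.cost R T := by
    rw [hcost]
    exact add_le_add (Finset.sum_le_sum fun v _ => I.withFree_openCost_le S₀ v) le_rfl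
  have h0 : (0 : ℝ) ≤ harmonic N := by
    have : 0 ≤ harmonic N := Finset.sum_nonneg fun _ _ => by positivity
    exact_mod_cast this
  have := mul_le_mul_of_nonneg_left hle (by linarith : (0 : ℝ) ≤ 1 + 2 * harmonic N)
  linarith

omit [DecidableEq V] in
-- `Partial` with allowance `k` is affordable because `S` is a valid comparison, so minimality gives
-- an allowance of at most `k`.
theorem exists_boughtSol_bounds [Nonempty V] (hPC : I.IsPrizeCollectingApprox γ Rhat PC)
    (hγ : 1 ≤ γ) {S : Solution V m} {k : ℕ} (hS : S.unserved.card ≤ k) (hk : k ≤ m) {x : ℝ}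
    (hx : I.cost Rhat S ≤ x) :
    ((I.boughtSol γ Rhat PC x).unserved.card : ℝ) ≤ 2 * γ * k ∧
      I.cost Rhat (I.boughtSol γ Rhat PC x) ≤ 3 * γ * x := by
  obtain ⟨u, hu, huc, hmin⟩ := I.boughtSol_eq_partialSol (req := Rhat) (PC := PC) hγ
    ((I.cost_nonneg Rhat S).trans hx)
  have huk : u ≤ k := hmin k hk ((cost_partialSol_le hPC hγ hS).trans
    (mul_le_mul_of_nonneg_left hx (by linarith)))
  rw [hu]
  refine ⟨(partialSol_unserved_card_le hPC hγ u).trans ?_, huc⟩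
  gcongr

theorem algCost_le_harmonic [Nonempty V] (hmax : ∀ (g : V → ℝ) (v : V), g v ≤ g (argmax g))
    (hγ : 1 ≤ γ) (hPC : I.IsPrizeCollectingApprox γ Rhat PC) {Δ : ℕ} {D : ℝ}
    (hD : I.IsMetricError R Rhat Δ D) {T : Solution V n} (hT : T.unserved = ∅) {N : ℕ}
    (hN : n ≤ N ∨ (1 + 2 * γ) * Δ < N + 1) :
    I.algCost argmax γ R Rhat PC ≤ 8 * γ * (4 * (I.cost R T + D) +
      2 * (2 * (D + 12 * γ * (I.cost R T + D) + (1 + 2 * harmonic N) * I.cost R T))) := by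
  obtain ⟨A, B, -, ⟨⟨e, rfl⟩, -⟩, hΔ⟩ := hD
  set D := ∑ i, I.dist (R i.1) (Rhat (e i).1) with hDdef
  have hD0 : 0 ≤ D := Finset.sum_nonneg fun i _ => I.dist_nonneg _ _
  have hc0 := I.cost_nonneg R T
  have h0 : (0 : ℝ) ≤ harmonic N := by
    have : 0 ≤ harmonic N := Finset.sum_nonneg fun _ _ => by positivity
    exact_mod_cast this
  obtain ⟨S, hS, hSc⟩ := exists_solution_of_matching (I := I) (R := R) (Rhat := Rhat) hT e
  have hk : Bᶜ.card ≤ m := (Finset.card_le_univ _).trans_eq (Fintype.card_fin m)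
  -- The constant 12 is `3 * 4`: the decisive purchase is made with a budget of at most `4Q`.
  refine algCost_le_of_phases (Rich := fun S₀ => ∃ P : Solution V m, P.opened ⊆ S₀ ∧
    (P.unserved.card : ℝ) ≤ 2 * γ * Bᶜ.card ∧ I.cost Rhat P ≤ 12 * γ * (I.cost R T + D))
    hmax hγ (by positivity) (by positivity) ?_ ?_ ?_ ?_
  · rintro S S' hSS ⟨P, h1, h2⟩
    exact ⟨P, h1.trans hSS, h2⟩
  · intro x hx hx4
    obtain ⟨h1, h2⟩ := exists_boughtSol_bounds hPC hγ hS hk (hSc.trans hx)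
    refine ⟨_, Finset.Subset.refl _, h1, h2.trans ?_⟩
    have := mul_le_mul_of_nonneg_left hx4 (by linarith : 0 ≤ 3 * γ)
    linarith
  · intro S₀ l i
    obtain ⟨σ, -, hmem, hcost⟩ := exists_assign_of_unserved_eq_empty (I := I) (R := R) hT
    have h1 := (I.withFree S₀).amortizedCost_runOnline_le hmax l (R i) (σ i)
    have h2 : (I.withFree S₀).dist (σ i) (R i) ≤ ∑ j, I.dist (σ j) (R j) :=
      Finset.single_le_sum (f := fun j => I.dist (σ j) (R j))
        (fun j _ => I.dist_nonneg _ _) (Finset.mem_univ i)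
    have h3 := Finset.single_le_sum (f := I.openCost) (fun v _ => I.openCost_nonneg v) (hmem i)
    linarith [I.withFree_openCost_le S₀ (σ i)]
  · rintro S₀ ⟨P, h1, h2, h3⟩ q hq
    have hn : n ≤ N ∨ Aᶜ.card + P.unserved.card ≤ N := by
      refine hN.imp_right fun h => ?_
      -- The count is an integer at most `(1 + 2γ)Δ < N + 1`, hence at most `N`.
      rw [← Nat.lt_succ_iff]
      have hA : (Aᶜ.card : ℝ) + Bᶜ.card = Δ := by exact_mod_cast hΔ
      have hA0 : 0 ≤ 2 * γ * (Aᶜ.card : ℝ) := by positivity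
      have hB0 : (0 : ℝ) ≤ Bᶜ.card := by positivity
      have : ((Aᶜ.card + P.unserved.card : ℕ) : ℝ) < ((N + 1 : ℕ) : ℝ) := by
        push_cast
        rw [← hA] at h
        linarith
      exact_mod_cast this
    have h4 := I.amortSum_withFree_le (R := R) (Rhat := Rhat) hmax hT e P h1 hn hq
    rw [← hDdef] at h4
    linarith

end Main

end Instance

/-! ### From harmonic numbers to logarithms, and the final constant. -/

theorem exists_nat_bound_harmonic {γ : ℝ} (hγ : 1 ≤ γ) (n Δ : ℕ) :
    ∃ N : ℕ, (n ≤ N ∨ (1 + 2 * γ) * Δ < N + 1) ∧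
      (harmonic N : ℝ) ≤ (3 + 2 * Real.log (1 + 2 * γ)) * Real.log ((min n Δ : ℕ) + 2) := by
  set M := min n Δ with hM
  have hpos : 0 ≤ (1 + 2 * γ) * M := by positivity
  refine ⟨⌊(1 + 2 * γ) * M⌋₊, ?_, ?_⟩
  · rcases le_total n Δ with h | h
    · left
      rw [hM, min_eq_left h]
      refine Nat.le_floor ?_
      exact le_mul_of_one_le_left (by positivity) (by linarith)
    · right
      rw [hM, min_eq_right h]
      exact Nat.lt_floor_add_one _
  -- As the logarithm is at least 1/2, the additive terms `1` and `log (1 + 2γ)` are absorbed at the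
  -- price of a factor 2.
  · have hlog : (1 : ℝ) / 2 ≤ Real.log (M + 2) := by
      have h1 : Real.log 2 ≤ Real.log (M + 2) := Real.log_le_log (by norm_num) (by simp)
      linarith [Real.log_two_gt_d9]
    have hκ : 0 ≤ Real.log (1 + 2 * γ) := Real.log_nonneg (by linarith)
    have h1 := harmonic_le_one_add_log ⌊(1 + 2 * γ) * M⌋₊
    have h2 : Real.log (⌊(1 + 2 * γ) * M⌋₊ : ℕ) ≤ Real.log ((1 + 2 * γ) * (M + 2)) := by
      rcases Nat.eq_zero_or_pos ⌊(1 + 2 * γ) * (M : ℝ)⌋₊ with h | h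
      · rw [h, Nat.cast_zero, Real.log_zero]
        refine Real.log_nonneg ?_
        nlinarith
      · refine Real.log_le_log (by exact_mod_cast h) ((Nat.floor_le hpos).trans ?_)
        linarith
    rw [Real.log_mul (by positivity) (by positivity)] at h2
    have := mul_le_mul_of_nonneg_left hlog hκ
    linarith

end FacilityLocation

theorem mainTheorem3 (γ : ℝ) (hγ : 1 ≤ γ) :
    ∃ C : ℝ, 0 < C ∧
      ∀ (V : Type*) [Finite V] [DecidableEq V] (I : FacilityLocation.Instance V)
        (argmax : (V → ℝ) → V) (_ : ∀ (g : V → ℝ) (v : V), g v ≤ g (argmax g))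
        (n m : ℕ) (R : Fin n → V) (Rhat : Fin m → V)
        (PC : (Fin m → ℝ) → FacilityLocation.Solution V m)
        (_ : I.IsPrizeCollectingApprox γ Rhat PC)
        (Δ : ℕ) (D : ℝ) (_ : I.IsMetricError R Rhat Δ D),
        I.algCost argmax γ R Rhat PC ≤
          C * Real.log ((min n Δ : ℕ) + 2) * I.opt R + C * D := by
  have hκ : 0 ≤ Real.log (1 + 2 * γ) := Real.log_nonneg (by linarith)
  -- Expanding `algCost_le_harmonic` gives `64γ + 384γ² + 64γ H_N` times the cost of `T`. The first
  -- two terms double because the logarithm may be as small as 1/2, and `H_N` brings `3 + 2 log (1 +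
  -- 2γ)`.
  refine ⟨128 * γ + 768 * γ ^ 2 + 64 * γ * (3 + 2 * Real.log (1 + 2 * γ)), by positivity, ?_⟩
  intro V _ _ I argmax hmax n m R Rhat PC hPC Δ D hD
  have : Nonempty V := I.connected.nonempty
  obtain ⟨N, hN, hH⟩ := FacilityLocation.exists_nat_bound_harmonic hγ n Δ
  set ℓ := Real.log ((min n Δ : ℕ) + 2) with hℓ
  set κ := Real.log (1 + 2 * γ)
  have hlog : (1 : ℝ) / 2 ≤ ℓ := by
    have h1 : Real.log 2 ≤ ℓ := Real.log_le_log (by norm_num) (by simp)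
    linarith [Real.log_two_gt_d9]
  have hD0 : 0 ≤ D := by
    obtain ⟨A, B, -, ⟨⟨e, rfl⟩, -⟩, -⟩ := hD
    exact Finset.sum_nonneg fun i _ => I.dist_nonneg _ _
  set C := 128 * γ + 768 * γ ^ 2 + 64 * γ * (3 + 2 * κ) with hC
  have hCpos : 0 < C := by positivity
  have hCℓ : 0 < C * ℓ := mul_pos hCpos (by linarith)
  have key : ∀ T : FacilityLocation.Solution V n, T.unserved = ∅ →
      I.algCost argmax γ R Rhat PC ≤ C * ℓ * I.cost R T + C * D := by
    intro T hT
    have h := I.algCost_le_harmonic hmax hγ hPC hD hT hN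
    have hc0 := I.cost_nonneg R T
    have h1 : 64 * γ * (I.cost R T * harmonic N) ≤ 64 * γ * (I.cost R T * ((3 + 2 * κ) * ℓ)) := by
      gcongr
    have h2 : (64 * γ + 384 * γ ^ 2) * I.cost R T * (1 / 2) ≤
        (64 * γ + 384 * γ ^ 2) * I.cost R T * ℓ :=
      mul_le_mul_of_nonneg_left hlog (by positivity)
    have h3 : 0 ≤ (64 * γ + 384 * γ ^ 2 + 64 * γ * (3 + 2 * κ)) * D := by positivity
    rw [hC]
    linarith
  -- `opt` is an infimum, so the bound for every `T` is rearranged into a lower bound for it.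
  have hopt : (I.algCost argmax γ R Rhat PC - C * D) / (C * ℓ) ≤ I.opt R := by
    refine le_csInf ?_ ?_
    · obtain ⟨v⟩ := this
      exact ⟨_, FacilityLocation.Instance.singleSol v n,
        FacilityLocation.Instance.singleSol_unserved v, rfl⟩
    · rintro _ ⟨T, hT, rfl⟩
      rw [div_le_iff₀ hCℓ]
      linarith [key T hT]
  rw [div_le_iff₀ hCℓ] at hopt
  linarith
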